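/- Let $H_1,H_2$ be real Hilbert spaces (possibly infinite-dimensional), let $L:H_1\to H_2$ be a bounded linear operator with adjoint $L^*$, let $g:H_1\to\mathbb R\cup\{\infty\}$ and $f:H_2\to\mathbb R\cup\{\infty\}$ be proper, convex and lower semicontinuous, and let $\lambda>0$. Consider the primal and dual problems $$(P)\quad \min_{u\in H_1}\{g(u)+f(Lu)\},\qquad (D)\quad -\min_{b\in H_2}\{g^*(-L^*b)+f^*(b)\},$$ where $g^*,f^*$ are the Fenchel conjugates. Assume that both (P) and (D) have optimal solutions, that at least one of the regularity conditions (i) there is $x\in H_1$ with $g(x)<\infty$ and $f(Lx)<\infty$ such that $f$ is continuous at $Lx$, (ii) $0\in\operatorname{int}\,(L\,\mathrm{dom}(g)-\mathrm{dom}(f))$ holds, and that $L^*L:H_1\to H_1$ is surjective. Then for all $b,d\in H_2$ and $v\in H_1$ the functionals $u\mapsto g(u)+\frac\lambda2\|b+Lu-d\|^2$ on $H_1$ and $z\mapsto f(z)+\frac\lambda2\|b+Lv-z\|^2$ on $H_2$ have minimizers, so that the following approximate alternating split Bregman algorithm with error tolerances $\alpha_k,\beta_k\ge 0$ $(k\ge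 1)$ is well defined: starting from arbitrary $b^0,d^0\in H_2$, for $k\ge1$, 1. find $u^k\in H_1$ with $\|Lu^k-Lu^k_{ex}\|\le\alpha_k$, where $u^k_{ex}$ is a minimizer on $H_1$ of $u\mapsto g(u)+\frac\lambda2\|b^{k-1}+Lu-d^{k-1}\|^2$; 2. find $d^k\in H_2$ with $\|d^k-d^k_{ex}\|\le\beta_k$, where $d^k_{ex}$ is the minimizer on $H_2$ of $d\mapsto f(d)+\frac\lambda2\|b^{k-1}+Lu^k-d\|^2$; 3. let $b^k=b^{k-1}+Lu^k-d^k$. Suppose in addition that $\sum_{k=1}^\infty(\alpha_k+\beta_k)<\infty$, and let $\{u^k\}$, $\{d^k\}$, $\{b^k\}$ be any sequences generated by this algorithm. Then $\{d^k\}$ and $\{b^k\}$ converge weakly to some $\hat d$ and $\hat b$, respectively; $\lambda\hat b$ is a solution of (D); the sequence $\{d^k-Lu^{k+1}\}$ converges strongly to zero, and $$\sum_{k=0}^\infty\|d^k-Lu^{k+1}\|^2<\infty .$$ Furthermore, there is a unique $\hat u\in H_1$ with $L\hat u=\hat d$, and $\hat u$ is a solution of (P). In particular, $\{u^k\}$ has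 at most one weak cluster point, and any such point equals $\hat u$. -/

import Mathlib

open Filter Topology Set
open scoped Pointwise

noncomputable section

namespace SplitBregman

/-- Effective domain of an extended-real-valued function. -/
def dom {H : Type*} (F : H → EReal) : Set H := {x | F x < ⊤}

/-- A proper convex lower semicontinuous function `F : H → ℝ ∪ {∞}`. -/
structure ProperConvexLsc {H : Type*} [NormedAddCommGroup H] [InnerProductSpace ℝ H]
    (F : H → EReal) : Prop where
  ne_bot : ∀ x, F x ≠ ⊥
  dom_nonempty : (dom F).Nonempty
  convex : ∀ x y : H, ∀ a b : ℝ, 0 < a → 0 < b → a + b = 1 →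
    F (a • x + b • y) ≤ (a : EReal) * F x + (b : EReal) * F y
  lsc : LowerSemicontinuous F

/-- Fenchel conjugate `F*(y) = sup_x (⟨x, y⟩ - F x)`, under the Riesz identification. -/
def conjugate {H : Type*} [NormedAddCommGroup H] [InnerProductSpace ℝ H]
    (F : H → EReal) (y : H) : EReal :=
  ⨆ x : H, ((inner ℝ x y : ℝ) : EReal) - F x

/-- `x` is an optimal solution of `min F`: the minimum is finite from above and attained at `x`. -/
def IsSolution {H : Type*} (F : H → EReal) (x : H) : Prop :=
  F x < ⊤ ∧ IsMinOn F univ x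

section

variable {H₁ H₂ : Type*} [NormedAddCommGroup H₁] [InnerProductSpace ℝ H₁] [CompleteSpace H₁]
  [NormedAddCommGroup H₂] [InnerProductSpace ℝ H₂] [CompleteSpace H₂]

/-- Objective of the primal problem (P). -/
def primalObj (g : H₁ → EReal) (f : H₂ → EReal) (L : H₁ →L[ℝ] H₂) (u : H₁) : EReal :=
  g u + f (L u)

/-- The function minimized in the dual problem (D), `-min_b {g*(-L* b) + f*(b)}`. -/
def dualObj (g : H₁ → EReal) (f : H₂ → EReal) (L : H₁ →L[ℝ] H₂) (b : H₂) : EReal :=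
  conjugate g (-(ContinuousLinearMap.adjoint L b)) + conjugate f b

/-- Regularity condition for Fenchel duality: either `f` is continuous at `L x` for some
`x ∈ dom g ∩ dom (f ∘ L)`, or `0 ∈ int (L (dom g) - dom f)`. -/
def Regularity (g : H₁ → EReal) (f : H₂ → EReal) (L : H₁ →L[ℝ] H₂) : Prop :=
  (∃ x, x ∈ dom g ∧ L x ∈ dom f ∧ ContinuousAt f (L x)) ∨
    (0 : H₂) ∈ interior (L '' dom g - dom f)

/-- The functional `u ↦ g(u) + (lam/2) ‖b + L u - d‖²` of the first step. -/
def stepOne (g : H₁ → EReal) (L : H₁ →L[ℝ] H₂) (lam : ℝ) (b d : H₂) (u : H₁) : EReal :=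
  g u + ((lam / 2 * ‖b + L u - d‖ ^ 2 : ℝ) : EReal)

/-- The functional `d ↦ f(d) + (lam/2) ‖b + L u - d‖²` of the second step. -/
def stepTwo (f : H₂ → EReal) (L : H₁ →L[ℝ] H₂) (lam : ℝ) (b : H₂) (u : H₁) (d : H₂) : EReal :=
  f d + ((lam / 2 * ‖b + L u - d‖ ^ 2 : ℝ) : EReal)

/-- Both minimization steps are solvable, whatever the current iterates are. -/
def WellDefined (g : H₁ → EReal) (f : H₂ → EReal) (L : H₁ →L[ℝ] H₂) (lam : ℝ) : Prop :=
  (∀ b d : H₂, ∃ u, IsMinOn (stepOne g L lam b d) univ u) ∧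
    (∀ (b : H₂) (u : H₁), ∃ d, IsMinOn (stepTwo f L lam b u) univ d)

/-- `u`, `d`, `b` are generated by the approximate alternating split Bregman algorithm with error
tolerances `α`, `β`, from the arbitrary initial values `b 0`, `d 0`. Step number `k + 1` computes
`u (k + 1)`, `d (k + 1)`, `b (k + 1)`; the values `u 0`, `α 0`, `β 0` play no role. -/
structure IsApproxRun (g : H₁ → EReal) (f : H₂ → EReal) (L : H₁ →L[ℝ] H₂) (lam : ℝ)
    (α β : ℕ → ℝ) (u : ℕ → H₁) (d b : ℕ → H₂) : Prop where
  step_u : ∀ k, ∃ uex, IsMinOn (stepOne g L lam (b k) (d k)) univ uex ∧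
    ‖L (u (k + 1)) - L uex‖ ≤ α (k + 1)
  step_d : ∀ k, ∃ dex, IsMinOn (stepTwo f L lam (b k) (u (k + 1))) univ dex ∧
    ‖d (k + 1) - dex‖ ≤ β (k + 1)
  step_b : ∀ k, b (k + 1) = b k + L (u (k + 1)) - d (k + 1)

end

/-- Weak convergence of a sequence. -/
def WeakTendsto {H : Type*} [NormedAddCommGroup H] [InnerProductSpace ℝ H]
    (x : ℕ → H) (a : H) : Prop :=
  Tendsto (fun k => toWeakSpace ℝ H (x k)) atTop (𝓝 (toWeakSpace ℝ H a))

/-- `a` is a cluster point of the sequence `x` in the weak topology. In particular every weak limit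
of a subsequence is one. -/
def IsWeakClusterPt {H : Type*} [NormedAddCommGroup H] [InnerProductSpace ℝ H]
    (x : ℕ → H) (a : H) : Prop :=
  MapClusterPt (toWeakSpace ℝ H a) atTop (fun k => toWeakSpace ℝ H (x k))

end SplitBregman

end

/-! Put `s k = b (k+1) + d (k+1)`. Up to errors controlled by the tolerances, the algorithm is a
Douglas-Rachford iteration: `p` is the proximal point of `f` at `s`, `v` minimizes `g` plus `lam/2`
times the squared distance of `L v` to `2p - s`, and `s` moves to `s - p + L v`.

A KKT pair `(z, lam • w)` makes `L z + w` a fixed point. Firm nonexpansiveness of both proximal maps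
shows that an exact step does not increase the distance to it, with decrement `‖p - L v‖ ^ 2`
(`IsKKT.fejer`). With summable errors the distances still converge and the decrements are summable
(`summable_of_quasiFejer`). Some KKT pair exists, by Baire and Hahn-Banach separation
(`exists_isKKT`).

Surjectivity of `L* L` bounds `L` below, so the `v k` are bounded too. Along any ultrafilter finer
than `atTop`, weak limits of `s` and `v` yield a KKT pair (`isKKT_of_wTendsto`). Opial's argument
shows that these ultrafilters share one limit of `s`, and the proximal map of `f` then fixes that of
`p`. KKT pairs solve both problems, and injectivity of `L` recovers the primal point. -/

namespace SplitBregman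

/-! ### Weak limits in Hilbert space along filters and ultrafilters. -/

section WeakConvergence

variable {ι H K : Type*} [NormedAddCommGroup H] [InnerProductSpace ℝ H]
  [NormedAddCommGroup K] [InnerProductSpace ℝ K]

/-- Weak convergence of `x` to `a` along a filter, tested against inner products. -/
def WTendsto (x : ι → H) (l : Filter ι) (a : H) : Prop :=
  ∀ y, Tendsto (fun i => inner ℝ (x i) y) l (𝓝 (inner ℝ a y))

theorem tendsto_toWeakSpace_iff [CompleteSpace H] {x : ι → H} {l : Filter ι} {a : H} :
    Tendsto (fun i => toWeakSpace ℝ H (x i)) l (𝓝 (toWeakSpace ℝ H a)) ↔ WTendsto x l a := by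
  have hinj : Function.Injective (topDualPairing ℝ H).flip := by
    intro u v huv
    refine ext_inner_left ℝ fun w => ?_
    simpa using LinearMap.congr_fun huv (innerSL ℝ w)
  have key := WeakBilin.tendsto_iff_forall_eval_tendsto (l := l)
    (f := fun i => toWeakSpace ℝ H (x i)) (x := toWeakSpace ℝ H a) (topDualPairing ℝ H).flip hinj
  refine key.trans ⟨fun h y => ?_, fun h φ => ?_⟩
  · have := h (innerSL ℝ y)
    simp only [real_inner_comm y]
    exact this
  · obtain ⟨w, rfl⟩ := (InnerProductSpace.toDual ℝ H).surjective φ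
    have := h w
    simp only [real_inner_comm w] at this
    exact this

namespace WTendsto

variable {x y : ι → H} {l : Filter ι} {a c : H}

theorem add (hx : WTendsto x l a) (hy : WTendsto y l c) :
    WTendsto (fun i => x i + y i) l (a + c) := fun w => by
  simpa only [inner_add_left] using (hx w).add (hy w)

theorem sub (hx : WTendsto x l a) (hy : WTendsto y l c) :
    WTendsto (fun i => x i - y i) l (a - c) := fun w => by
  simpa only [inner_sub_left] using (hx w).sub (hy w)

theorem of_tendsto (hx : Tendsto x l (𝓝 a)) : WTendsto x l a := fun _ =>
  hx.inner tendsto_const_nhds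

theorem map [CompleteSpace H] [CompleteSpace K] (hx : WTendsto x l a) (L : H →L[ℝ] K) :
    WTendsto (fun i => L (x i)) l (L a) := fun w => by
  simpa only [← ContinuousLinearMap.adjoint_inner_right] using hx (ContinuousLinearMap.adjoint L w)

theorem unique [l.NeBot] (hx : WTendsto x l a) (hy : WTendsto x l c) : a = c :=
  ext_inner_right ℝ fun w => tendsto_nhds_unique (hx w) (hy w)

theorem mono {l' : Filter ι} (hx : WTendsto x l a) (h : l' ≤ l) : WTendsto x l' a := fun w =>
  (hx w).mono_left h

theorem of_sub_tendsto_zero (hx : WTendsto x l a) (h : Tendsto (fun i => y i - x i) l (𝓝 0)) :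
    WTendsto y l a := by
  simpa using (of_tendsto h).add hx

/-- Ultrafilters replace extraction of subsequences: bounded families always converge weakly along
them, and agreement of all the limits gives convergence. -/
theorem of_ultrafilter (h : ∀ U : Ultrafilter ι, ↑U ≤ l → WTendsto x U a) : WTendsto x l a :=
  fun w => (tendsto_iff_ultrafilter _ _ _).2 fun U hU => h U hU w

/-- Closed convex sets are stable under weak limits. -/
theorem mem_of_isClosed [CompleteSpace H] [l.NeBot] (hx : WTendsto x l a) {C : Set H}
    (hC : Convex ℝ C) (hC' : IsClosed C) (h : ∀ᶠ i in l, x i ∈ C) : a ∈ C := by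
  by_contra ha
  obtain ⟨φ, t, hφa, hφ⟩ := geometric_hahn_banach_point_closed hC hC' ha
  obtain ⟨w, rfl⟩ := (InnerProductSpace.toDual ℝ H).surjective φ
  simp only [InnerProductSpace.toDual_apply_apply] at hφa hφ
  have hlim := hx w
  simp only [real_inner_comm w] at hlim
  have := ge_of_tendsto hlim (h.mono fun i hi => (hφ _ hi).le)
  linarith

/-- The norm is weakly lower semicontinuous. -/
theorem norm_le_of_tendsto [l.NeBot] (hx : WTendsto x l a) {n : ℝ}
    (h : Tendsto (fun i => ‖x i‖) l (𝓝 n)) : ‖a‖ ≤ n := by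
  have h1 : inner ℝ a a ≤ n * ‖a‖ :=
    le_of_tendsto_of_tendsto' (hx a) (h.mul_const ‖a‖) fun i => real_inner_le_norm _ _
  rw [real_inner_self_eq_norm_mul_norm] at h1
  have hn : 0 ≤ n := ge_of_tendsto' h fun i => norm_nonneg _
  by_contra! hlt
  nlinarith

end WTendsto

theorem exists_tendsto_of_bounded (U : Ultrafilter ι) {x : ι → ℝ} {B : ℝ}
    (hB : ∀ᶠ i in (U : Filter ι), |x i| ≤ B) : ∃ t, Tendsto x U (𝓝 t) := by
  obtain ⟨t, -, ht⟩ := (isCompact_Icc (a := -B) (b := B)).ultrafilter_le_nhds (U.map x)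
    (le_principal_iff.2 (hB.mono fun i hi => abs_le.1 hi))
  exact ⟨t, ht⟩

/-- Bounded families have weak limits along ultrafilters. -/
theorem exists_wTendsto_of_bounded [CompleteSpace H] (U : Ultrafilter ι) {x : ι → H} {B : ℝ}
    (hB : ∀ᶠ i in (U : Filter ι), ‖x i‖ ≤ B) : ∃ a, WTendsto x U a := by
  have hlim : ∀ y : H, ∃ t : ℝ, Tendsto (fun i => inner ℝ (x i) y) U (𝓝 t) := by
    exact fun y => exists_tendsto_of_bounded U (B := B * ‖y‖) (hB.mono fun i hi =>
      (abs_real_inner_le_norm _ _).trans (mul_le_mul_of_nonneg_right hi (norm_nonneg _)))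
  choose T hT using hlim
  -- The limits of the inner products form a bounded linear functional; Riesz represents it by the
  -- weak limit.
  let φ : H →ₗ[ℝ] ℝ :=
    { toFun := T
      map_add' := fun y z => tendsto_nhds_unique (hT _) (by
        simpa only [inner_add_right] using (hT y).add (hT z))
      map_smul' := fun c y => tendsto_nhds_unique (hT _) (by
        simpa only [inner_smul_right, smul_eq_mul, RingHom.id_apply] using (hT y).const_mul c) }
  have hφ : ∀ y, ‖φ y‖ ≤ B * ‖y‖ := fun y => by
    refine le_of_tendsto (hT y).norm (hB.mono fun i hi => ?_)
    exact (norm_inner_le_norm _ _).trans (mul_le_mul_of_nonneg_right hi (norm_nonneg _))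
  refine ⟨(InnerProductSpace.toDual ℝ H).symm (φ.mkContinuous B hφ), fun y => ?_⟩
  rw [InnerProductSpace.toDual_symm_apply]
  exact hT y

end WeakConvergence

/-! ### Convex functions, subgradients and proximal minimization. -/

section ConvexFunctions

variable {ι H K : Type*} [NormedAddCommGroup H] [InnerProductSpace ℝ H]
  [NormedAddCommGroup K] [InnerProductSpace ℝ K]

namespace ProperConvexLsc

variable {F : H → EReal}

theorem exists_eq_coe (hF : ProperConvexLsc F) {x : H} (hx : F x < ⊤) : ∃ r : ℝ, F x = r :=
  ⟨(F x).toReal, (EReal.coe_toReal hx.ne (hF.ne_bot x)).symm⟩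

/-- Working with real upper bounds instead of values keeps later arithmetic in `ℝ`. -/
theorem combo_le (hF : ProperConvexLsc F) {x y : H} {s t a b : ℝ} (hx : F x ≤ s) (hy : F y ≤ t)
    (ha : 0 < a) (hb : 0 < b) (hab : a + b = 1) :
    F (a • x + b • y) ≤ ((a * s + b * t : ℝ) : EReal) := by
  refine (hF.convex x y a b ha hb hab).trans ?_
  rw [EReal.coe_add, EReal.coe_mul, EReal.coe_mul]
  exact add_le_add (mul_le_mul_of_nonneg_left hx (EReal.coe_nonneg.2 ha.le))
    (mul_le_mul_of_nonneg_left hy (EReal.coe_nonneg.2 hb.le))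

theorem convex_sublevel (hF : ProperConvexLsc F) (t : ℝ) : Convex ℝ {x | F x ≤ t} := by
  refine convex_iff_forall_pos.2 fun x hx y hy a b ha hb hab => ?_
  have := hF.combo_le hx hy ha hb hab
  rwa [← add_mul, hab, one_mul] at this

theorem isClosed_sublevel (hF : ProperConvexLsc F) (t : ℝ) : IsClosed {x | F x ≤ t} :=
  hF.lsc.isClosed_preimage _

/-- Proper convex lower semicontinuous functions are weakly lower semicontinuous. -/
theorem le_of_wTendsto [CompleteSpace H] (hF : ProperConvexLsc F) {x : ι → H} {l : Filter ι}
    [l.NeBot] {a : H} {ρ : ι → ℝ} {r : ℝ} (hx : WTendsto x l a) (hρ : Tendsto ρ l (𝓝 r))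
    (h : ∀ᶠ i in l, F (x i) ≤ ρ i) : F a ≤ r := by
  refine EReal.le_of_forall_lt_iff_le.1 fun z hz => ?_
  refine hx.mem_of_isClosed (hF.convex_sublevel z) (hF.isClosed_sublevel z) ?_
  filter_upwards [h, hρ.eventually_lt_const (EReal.coe_lt_coe_iff.1 hz)] with i hi hi'
  exact hi.trans (EReal.coe_le_coe_iff.2 hi'.le)

/-- A proper convex lower semicontinuous function decreases at most linearly. -/
theorem exists_linear_minorant (hF : ProperConvexLsc F) :
    ∃ A C : ℝ, 0 ≤ C ∧ ∀ x (t : ℝ), F x ≤ t → A - C * ‖x‖ ≤ t := by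
  obtain ⟨x₀, hx₀⟩ := hF.dom_nonempty
  obtain ⟨r, hr⟩ := hF.exists_eq_coe hx₀
  have hev : ∀ᶠ y in 𝓝 x₀, ((r - 1 : ℝ) : EReal) < F y :=
    hF.lsc x₀ _ (show _ < F x₀ by rw [hr]; exact EReal.coe_lt_coe_iff.2 (sub_one_lt r))
  obtain ⟨ε, hε, hball⟩ := Metric.eventually_nhds_iff.1 hev
  refine ⟨r - 1 - 2 / ε * ‖x₀‖, 2 / ε, by positivity, fun x t hx => ?_⟩
  have htri : 2 / ε * ‖x - x₀‖ ≤ 2 / ε * ‖x‖ + 2 / ε * ‖x₀‖ := by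
    rw [← mul_add]
    exact mul_le_mul_of_nonneg_left (norm_sub_le _ _) (by positivity)
  suffices r - 1 - 2 / ε * ‖x - x₀‖ ≤ t by linarith
  have hpos : 0 ≤ 2 / ε * ‖x - x₀‖ := by positivity
  rcases lt_or_ge ‖x - x₀‖ ε with hlt | hge
  · have := (hball (y := x) (by rwa [dist_eq_norm])).trans_le hx
    have := EReal.coe_lt_coe_iff.1 this
    linarith
  · have hn : 0 < ‖x - x₀‖ := hε.trans_le hge
    -- This `θ` puts the point of the segment at distance `ε / 2` from `x₀`, where `F > r - 1`;
    -- convexity then bounds `t` below by `r - 1 / θ`.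
    set θ : ℝ := ε / (2 * ‖x - x₀‖) with hθ
    have hθ0 : 0 < θ := by positivity
    have hθ1 : θ < 1 := by rw [hθ, div_lt_one (by positivity)]; linarith
    have hy : ‖((1 - θ) • x₀ + θ • x) - x₀‖ = ε / 2 := by
      have : ((1 - θ) • x₀ + θ • x) - x₀ = θ • (x - x₀) := by module
      rw [this, norm_smul, Real.norm_of_nonneg hθ0.le, hθ]
      field_simp
    have h1 := hball (y := (1 - θ) • x₀ + θ • x) (by rw [dist_eq_norm, hy]; linarith)
    have h2 := h1.trans_le (hF.combo_le hr.le hx (sub_pos.2 hθ1) hθ0 (by ring))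
    have h3 := EReal.coe_lt_coe_iff.1 h2
    have h4 : 2 / ε * ‖x - x₀‖ = 1 / θ := by rw [hθ]; field_simp
    have h5 : θ * (1 / θ) = 1 := by field_simp
    rw [h4]
    by_contra! hcon
    have h6 : θ * t < θ * (r - 1 - 1 / θ) := mul_lt_mul_of_pos_left hcon hθ0
    nlinarith

end ProperConvexLsc

/-- `M* v` is a subgradient of `F` at `x`, where `F x` is finite. -/
def SubgradAt (F : H → EReal) (M : H →L[ℝ] K) (x : H) (v : K) : Prop :=
  ∃ r : ℝ, F x = r ∧ ∀ y (t : ℝ), F y ≤ t → r + inner ℝ v (M y - M x) ≤ t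

theorem SubgradAt.monotone {F : H → EReal} {M : H →L[ℝ] K} {x y : H} {v w : K}
    (hx : SubgradAt F M x v) (hy : SubgradAt F M y w) : 0 ≤ inner ℝ (v - w) (M x - M y) := by
  obtain ⟨r, hr, hx⟩ := hx
  obtain ⟨s, hs, hy⟩ := hy
  have h1 := hx y s hs.le
  have h2 := hy x r hr.le
  rw [← neg_sub, inner_neg_right] at h1
  rw [inner_sub_left]
  linarith

/-- The proximal map of `F` seen through `M` is firmly nonexpansive. -/
theorem SubgradAt.norm_sq_le {F : H → EReal} {M : H →L[ℝ] K} {x y : H} {c c' : K} {lam : ℝ}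
    (hlam : 0 < lam) (hx : SubgradAt F M x (lam • (c - M x)))
    (hy : SubgradAt F M y (lam • (c' - M y))) :
    ‖M x - M y‖ ^ 2 ≤ inner ℝ (c - c') (M x - M y) := by
  have h := hx.monotone hy
  rw [← smul_sub, real_inner_smul_left] at h
  have h := nonneg_of_mul_nonneg_right h hlam
  have h' : c - M x - (c' - M y) = (c - c') - (M x - M y) := by abel
  rw [h', inner_sub_left, real_inner_self_eq_norm_sq] at h
  linarith

/-- Cauchy-Schwarz applied to firm nonexpansiveness. In particular `M x` is determined by `c`, even
if `x` is not. -/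
theorem SubgradAt.norm_le {F : H → EReal} {M : H →L[ℝ] K} {x y : H} {c c' : K} {lam : ℝ}
    (hlam : 0 < lam) (hx : SubgradAt F M x (lam • (c - M x)))
    (hy : SubgradAt F M y (lam • (c' - M y))) : ‖M x - M y‖ ≤ ‖c - c'‖ := by
  have h := hx.norm_sq_le hlam hy
  have h' := real_inner_le_norm (c - c') (M x - M y)
  by_contra! hlt
  nlinarith [norm_nonneg (c - c')]

/-- The functional `u ↦ F(u) + (lam/2) ‖M u - c‖²`. -/
noncomputable def proxObj (F : H → EReal) (M : H →L[ℝ] K) (lam : ℝ) (c : K) (u : H) : EReal :=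
  F u + ((lam / 2 * ‖M u - c‖ ^ 2 : ℝ) : EReal)

/-- Fermat's rule for `proxObj`. -/
theorem ProperConvexLsc.subgradAt_of_isMinOn {F : H → EReal} (hF : ProperConvexLsc F)
    {M : H →L[ℝ] K} {lam : ℝ} {c : K} {x : H} (hx : IsMinOn (proxObj F M lam c) univ x) :
    SubgradAt F M x (lam • (c - M x)) := by
  have hmin : ∀ y (t : ℝ), F y ≤ t →
      F x + ((lam / 2 * ‖M x - c‖ ^ 2 : ℝ) : EReal) ≤ ((t + lam / 2 * ‖M y - c‖ ^ 2 : ℝ) : EReal) :=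
    fun y t hy => (hx (mem_univ y)).trans (by rw [EReal.coe_add]; exact add_le_add_left hy _)
  obtain ⟨x₀, hx₀⟩ := hF.dom_nonempty
  obtain ⟨r₀, hr₀⟩ := hF.exists_eq_coe hx₀
  have hlt : F x < ⊤ := by
    refine lt_top_iff_ne_top.2 fun h => ?_
    have := hmin x₀ r₀ hr₀.le
    rw [h, EReal.top_add_coe] at this
    exact absurd this (not_le.2 (EReal.coe_lt_top _))
  obtain ⟨r, hr⟩ := hF.exists_eq_coe hlt
  refine ⟨r, hr, fun y t hy => ?_⟩
  -- Compare `x` with `(1 - θ) x + θ y` and divide by `θ`: the quadratic term survives only to order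
  -- `θ`.
  have key : ∀ θ : ℝ, 0 < θ → θ < 1 →
      r + inner ℝ (lam • (c - M x)) (M y - M x) - t ≤ θ * (lam / 2 * ‖M y - M x‖ ^ 2) := by
    intro θ h0 h1
    have h := hmin _ _ (hF.combo_le hr.le hy (sub_pos.2 h1) h0 (by ring))
    rw [hr, ← EReal.coe_add, EReal.coe_le_coe_iff] at h
    have h' : M ((1 - θ) • x + θ • y) - c = (M x - c) + θ • (M y - M x) := by
      simp only [map_add, map_smul]
      module
    rw [h', norm_add_sq_real, inner_smul_right, norm_smul, mul_pow, Real.norm_of_nonneg h0.le] at h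
    rw [← neg_sub (M x) c, smul_neg, inner_neg_left, real_inner_smul_left]
    refine le_of_mul_le_mul_left ?_ h0
    linarith
  have hlim : Tendsto (fun θ : ℝ => θ * (lam / 2 * ‖M y - M x‖ ^ 2)) (𝓝[>] 0) (𝓝 0) := by
    have : Tendsto (fun θ : ℝ => θ * (lam / 2 * ‖M y - M x‖ ^ 2)) (𝓝 0)
        (𝓝 (0 * (lam / 2 * ‖M y - M x‖ ^ 2))) := tendsto_id.mul_const _
    rw [zero_mul] at this
    exact this.mono_left nhdsWithin_le_nhds
  have := ge_of_tendsto hlim (b := r + inner ℝ (lam • (c - M x)) (M y - M x) - t) (by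
    filter_upwards [Ioo_mem_nhdsGT (zero_lt_one' ℝ)] with θ hθ using key θ hθ.1 hθ.2)
  linarith

/-- `proxObj` has a minimizer when `M` is bounded below. -/
theorem ProperConvexLsc.exists_isMinOn_proxObj [CompleteSpace H] [CompleteSpace K] {F : H → EReal}
    (hF : ProperConvexLsc F) {M : H →L[ℝ] K} {κ lam : ℝ} (hκ : 0 ≤ κ) (hM : ∀ x, ‖x‖ ≤ κ * ‖M x‖)
    (hlam : 0 < lam) (c : K) : ∃ x, IsMinOn (proxObj F M lam c) univ x := by
  obtain ⟨A, C, hC, hA⟩ := hF.exists_linear_minorant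
  obtain ⟨x₀, hx₀⟩ := hF.dom_nonempty
  obtain ⟨r₀, hr₀⟩ := hF.exists_eq_coe hx₀
  let V : Set ℝ := {s | ∃ x, ∃ t : ℝ, F x ≤ t ∧ s = t + lam / 2 * ‖M x - c‖ ^ 2}
  have hxn : ∀ x, ‖x‖ ≤ κ * (‖M x - c‖ + ‖c‖) := fun x => (hM x).trans
    (mul_le_mul_of_nonneg_left (by simpa using norm_add_le (M x - c) c) hκ)
  -- Coercivity: half of the quadratic absorbs the linear minorant by completing the square.
  have hlow : ∀ x (t : ℝ), F x ≤ t → A - C * κ * ‖c‖ - (C * κ) ^ 2 / lam +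
      lam / 4 * ‖M x - c‖ ^ 2 ≤ t + lam / 2 * ‖M x - c‖ ^ 2 := by
    intro x t hx
    have h1 := hA x t hx
    have h2 := mul_le_mul_of_nonneg_left (hxn x) hC
    have h3 : 0 ≤ (lam / 2 * ‖M x - c‖ - C * κ) ^ 2 / lam := by positivity
    have h4 : (lam / 2 * ‖M x - c‖ - C * κ) ^ 2 / lam =
        lam / 4 * ‖M x - c‖ ^ 2 - C * κ * ‖M x - c‖ + (C * κ) ^ 2 / lam := by
      field_simp
      ring
    linarith
  have hVne : V.Nonempty := ⟨_, x₀, r₀, hr₀.le, rfl⟩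
  have hVbd : BddBelow V := by
    refine ⟨A - C * κ * ‖c‖ - (C * κ) ^ 2 / lam, ?_⟩
    rintro s ⟨x, t, hx, rfl⟩
    have := hlow x t hx
    have : 0 ≤ lam / 4 * ‖M x - c‖ ^ 2 := by positivity
    linarith
  obtain ⟨s, -, hs, hsV⟩ := exists_seq_tendsto_sInf hVne hVbd
  choose x t hxt hst using hsV
  let U : Ultrafilter ℕ := hyperfilter ℕ
  have hU : (U : Filter ℕ) ≤ atTop := by
    rw [← Nat.cofinite_eq_atTop]; exact hyperfilter_le_cofinite
  have hsU : Tendsto s U (𝓝 (sInf V)) := hs.mono_left hU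
  obtain ⟨B, hB⟩ : ∃ B, ∀ᶠ n in (U : Filter ℕ), ‖M (x n) - c‖ ≤ B := by
    refine ⟨1 + 4 / lam * (sInf V + 1 - (A - C * κ * ‖c‖ - (C * κ) ^ 2 / lam)), ?_⟩
    filter_upwards [hsU.eventually_lt_const (lt_add_one _)] with n hn
    have h1 := hlow (x n) (t n) (hxt n)
    rw [← hst] at h1
    have h2 : lam / 4 * ‖M (x n) - c‖ ^ 2 ≤
        sInf V + 1 - (A - C * κ * ‖c‖ - (C * κ) ^ 2 / lam) := by linarith
    have h3 := mul_le_mul_of_nonneg_left h2 (show 0 ≤ 4 / lam by positivity)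
    have h4 : 4 / lam * (lam / 4 * ‖M (x n) - c‖ ^ 2) = ‖M (x n) - c‖ ^ 2 := by field_simp
    nlinarith [sq_nonneg (‖M (x n) - c‖ - 1)]
  obtain ⟨a, ha⟩ := exists_wTendsto_of_bounded U (x := x) (B := κ * (B + ‖c‖))
    (hB.mono fun n hn => (hxn _).trans (by gcongr))
  -- Once the norms converge, the upper bounds for `F (x n)` converge too, and lower semicontinuity
  -- applies to each summand separately.
  obtain ⟨ν, hν⟩ := exists_tendsto_of_bounded U (x := fun n => ‖M (x n) - c‖) (B := B)
    (hB.mono fun n hn => by rwa [abs_norm])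
  have hMa : ‖M a - c‖ ≤ ν :=
    ((ha.map M).sub (WTendsto.of_tendsto tendsto_const_nhds)).norm_le_of_tendsto hν
  have hFa : F a ≤ ((sInf V - lam / 2 * ν ^ 2 : ℝ) : EReal) := by
    refine hF.le_of_wTendsto ha (hsU.sub ((hν.pow 2).const_mul (lam / 2)))
      (Eventually.of_forall fun n => ?_)
    rw [hst n, add_sub_cancel_right]
    exact hxt n
  refine ⟨a, fun y _ => ?_⟩
  have h1 : proxObj F M lam c a ≤ (sInf V : ℝ) := by
    refine (add_le_add_left hFa _).trans ?_
    rw [← EReal.coe_add, EReal.coe_le_coe_iff]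
    have := mul_le_mul_of_nonneg_left (pow_le_pow_left₀ (norm_nonneg _) hMa 2)
      (show 0 ≤ lam / 2 by positivity)
    linarith
  refine h1.trans ?_
  rcases eq_or_ne (F y) ⊤ with hy | hy
  · rw [proxObj, hy, EReal.top_add_coe]
    exact le_top
  · obtain ⟨r, hr⟩ := hF.exists_eq_coe (lt_top_iff_ne_top.2 hy)
    rw [proxObj, hr, ← EReal.coe_add, EReal.coe_le_coe_iff]
    exact csInf_le hVbd ⟨y, r, hr.le, rfl⟩

end ConvexFunctions

/-! ### KKT pairs and Fenchel duality. -/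

section Duality

variable {H₁ H₂ : Type*} [NormedAddCommGroup H₁] [InnerProductSpace ℝ H₁]
  [NormedAddCommGroup H₂] [InnerProductSpace ℝ H₂]
  {g : H₁ → EReal} {f : H₂ → EReal} {L : H₁ →L[ℝ] H₂}

/-- Karush-Kuhn-Tucker pairs of the primal and dual problems. -/
def IsKKT (g : H₁ → EReal) (f : H₂ → EReal) (L : H₁ →L[ℝ] H₂) (u : H₁) (p : H₂) : Prop :=
  SubgradAt g L u (-p) ∧ SubgradAt f (ContinuousLinearMap.id ℝ H₂) (L u) p

/-- The inner products cancel when the two subgradient inequalities are added. -/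
theorem IsKKT.isSolution_primal (hg : ProperConvexLsc g) (hf : ProperConvexLsc f) {u : H₁} {p : H₂}
    (h : IsKKT g f L u p) : IsSolution (primalObj g f L) u := by
  obtain ⟨⟨r, hr, h1⟩, ⟨s, hs, h2⟩⟩ := h
  have hu : primalObj g f L u = ((r + s : ℝ) : EReal) := by rw [primalObj, hr, hs, EReal.coe_add]
  refine ⟨by rw [hu]; exact EReal.coe_lt_top _, fun y _ => ?_⟩
  rw [mem_ofPred_eq, hu, primalObj]
  rcases eq_or_ne (g y) ⊤ with hgy | hgy
  · rw [hgy, EReal.top_add_of_ne_bot (hf.ne_bot _)]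
    exact le_top
  rcases eq_or_ne (f (L y)) ⊤ with hfy | hfy
  · rw [hfy, EReal.add_top_of_ne_bot (hg.ne_bot _)]
    exact le_top
  obtain ⟨r', hr'⟩ := hg.exists_eq_coe (lt_top_iff_ne_top.2 hgy)
  obtain ⟨s', hs'⟩ := hf.exists_eq_coe (lt_top_iff_ne_top.2 hfy)
  have h1 := h1 y r' hr'.le
  have h2 := h2 (L y) s' hs'.le
  rw [inner_neg_left] at h1
  simp only [ContinuousLinearMap.id_apply] at h2
  rw [hr', hs', ← EReal.coe_add, EReal.coe_le_coe_iff]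
  linarith

/-- The conjugate is exact at a subgradient. -/
theorem SubgradAt.conjugate_le {F : H₂ → EReal} (hF : ProperConvexLsc F) {x w : H₂} {r : ℝ}
    (h : ∀ y (t : ℝ), F y ≤ t → r + inner ℝ w (y - x) ≤ t) :
    conjugate F w ≤ ((inner ℝ x w - r : ℝ) : EReal) := by
  refine iSup_le fun y => ?_
  rcases eq_or_ne (F y) ⊤ with hy | hy
  · rw [hy, EReal.sub_top]
    exact bot_le
  · obtain ⟨t, ht⟩ := hF.exists_eq_coe (lt_top_iff_ne_top.2 hy)
    have := h y t ht.le
    rw [inner_sub_right, real_inner_comm, real_inner_comm x w] at this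
    rw [ht, ← EReal.coe_sub, EReal.coe_le_coe_iff]
    linarith

/-- Both conjugates are exact at `p`, so the value there is at most `-r - s`; Fenchel-Young at `u`
and `L u` gives this lower bound at every `q`. -/
theorem IsKKT.isSolution_dual [CompleteSpace H₁] [CompleteSpace H₂]
    (hg : ProperConvexLsc g) (hf : ProperConvexLsc f) {u : H₁} {p : H₂}
    (h : IsKKT g f L u p) : IsSolution (dualObj g f L) p := by
  obtain ⟨⟨r, hr, h1⟩, ⟨s, hs, h2⟩⟩ := h
  have hconj_g : conjugate g (-(ContinuousLinearMap.adjoint L p)) ≤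
      ((-inner ℝ (L u) p - r : ℝ) : EReal) := by
    have := SubgradAt.conjugate_le hg (x := u) (w := -(ContinuousLinearMap.adjoint L p)) (r := r)
      fun y t hy => by
        have := h1 y t hy
        rwa [← map_sub, inner_neg_left, ← ContinuousLinearMap.adjoint_inner_left,
          ← inner_neg_left] at this
    rwa [inner_neg_right, ContinuousLinearMap.adjoint_inner_right] at this
  have hconj_f : conjugate f p ≤ ((inner ℝ (L u) p - s : ℝ) : EReal) :=
    SubgradAt.conjugate_le hf h2
  have hp : dualObj g f L p ≤ ((-r - s : ℝ) : EReal) := by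
    refine (add_le_add hconj_g hconj_f).trans_eq ?_
    rw [← EReal.coe_add]
    congr 1
    ring
  refine ⟨hp.trans_lt (EReal.coe_lt_top _), fun q _ => hp.trans ?_⟩
  have h3 : ((-inner ℝ (L u) q - r : ℝ) : EReal) ≤
      conjugate g (-(ContinuousLinearMap.adjoint L q)) := by
    refine le_trans (le_of_eq ?_) (le_iSup _ u)
    rw [hr, ← EReal.coe_sub, inner_neg_right, ContinuousLinearMap.adjoint_inner_right]
  have h4 : ((inner ℝ (L u) q - s : ℝ) : EReal) ≤ conjugate f q := by
    refine le_trans (le_of_eq ?_) (le_iSup _ (L u))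
    rw [hs, ← EReal.coe_sub]
  refine le_trans (le_of_eq ?_) (add_le_add h3 h4)
  rw [← EReal.coe_add]
  congr 1
  ring

/-- Continuity at `L x` makes `f` finite nearby, so `L x - dom f` is already a neighbourhood of `0`.
-/
theorem Regularity.zero_mem_interior (h : Regularity g f L) :
    (0 : H₂) ∈ interior (L '' dom g - dom f) := by
  rcases h with ⟨x, hxg, hxf, hc⟩ | h
  · rw [mem_interior_iff_mem_nhds]
    have h1 : Tendsto (fun y : H₂ => L x - y) (𝓝 0) (𝓝 (L x)) := by
      have : Continuous fun y : H₂ => L x - y := by fun_prop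
      simpa using this.tendsto 0
    filter_upwards [h1.eventually (hc.eventually (Iio_mem_nhds hxf))] with y hy
    exact ⟨L x, mem_image_of_mem _ hxg, L x - y, hy, by simp⟩
  · exact h

/-- Perturbations `y` for which the perturbed primal problem `g(u) + f(L u - y)` has a point `u`
bounded by `n` with both terms bounded by `n`. -/
def perturbSet (g : H₁ → EReal) (f : H₂ → EReal) (L : H₁ →L[ℝ] H₂) (n : ℝ) : Set H₂ :=
  {y | ∃ u, ‖u‖ ≤ n ∧ g u ≤ n ∧ f (L u - y) ≤ n}

theorem perturbSet_mono {m n : ℝ} (h : m ≤ n) : perturbSet g f L m ⊆ perturbSet g f L n :=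
  fun _ ⟨u, h1, h2, h3⟩ => ⟨u, h1.trans h, h2.trans (EReal.coe_le_coe_iff.2 h),
    h3.trans (EReal.coe_le_coe_iff.2 h)⟩

theorem convex_perturbSet (hg : ProperConvexLsc g) (hf : ProperConvexLsc f) (n : ℝ) :
    Convex ℝ (perturbSet g f L n) := by
  rintro y ⟨u, h1, h2, h3⟩ y' ⟨u', h1', h2', h3'⟩ a b ha hb hab
  refine ⟨a • u + b • u', ?_, hg.convex_sublevel n h2 h2' ha hb hab, ?_⟩
  · have := convex_closedBall (0 : H₁) n (mem_closedBall_zero_iff.2 h1)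
      (mem_closedBall_zero_iff.2 h1') ha hb hab
    exact mem_closedBall_zero_iff.1 this
  · have := hf.convex_sublevel n h3 h3' ha hb hab
    have h : L (a • u + b • u') - (a • y + b • y') = a • (L u - y) + b • (L u' - y') := by
      simp only [map_add, map_smul]
      module
    rw [h]
    exact this

/-- The norm bound on `u` supplies weak compactness, and all three bounds survive weak limits.
Baire's theorem needs this closedness. -/
theorem isClosed_perturbSet [CompleteSpace H₁] [CompleteSpace H₂]
    (hg : ProperConvexLsc g) (hf : ProperConvexLsc f) (n : ℝ) :
    IsClosed (perturbSet g f L n) := by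
  refine isClosed_of_closure_subset fun y hy => ?_
  obtain ⟨U, hU, hUy⟩ := mem_closure_iff_ultrafilter.1 hy
  have hex : ∀ z : H₂, ∃ u : H₁, z ∈ perturbSet g f L n → ‖u‖ ≤ n ∧ g u ≤ n ∧ f (L u - z) ≤ n := by
    intro z
    by_cases hz : z ∈ perturbSet g f L n
    · obtain ⟨u, hu⟩ := hz
      exact ⟨u, fun _ => hu⟩
    · exact ⟨0, fun h => absurd h hz⟩
  choose u hu using hex
  have hev : ∀ᶠ z in (U : Filter H₂), ‖u z‖ ≤ n ∧ g (u z) ≤ n ∧ f (L (u z) - z) ≤ n :=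
    mem_of_superset hU fun z hz => hu z hz
  obtain ⟨a, ha⟩ := exists_wTendsto_of_bounded U (hev.mono fun _ h => h.1)
  refine ⟨a, ?_, ?_, ?_⟩
  · exact mem_closedBall_zero_iff.1 (ha.mem_of_isClosed (convex_closedBall 0 n)
      Metric.isClosed_closedBall (hev.mono fun _ h => mem_closedBall_zero_iff.2 h.1))
  · exact hg.le_of_wTendsto ha tendsto_const_nhds (hev.mono fun _ h => h.2.1)
  · exact hf.le_of_wTendsto ((ha.map L).sub (WTendsto.of_tendsto (x := id) hUy)) tendsto_const_nhds
      (hev.mono fun _ h => h.2.2)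

theorem exists_mem_perturbSet (hg : ProperConvexLsc g) (hf : ProperConvexLsc f) {y : H₂}
    (hy : y ∈ L '' dom g - dom f) : ∃ n : ℕ, y ∈ perturbSet g f L n := by
  obtain ⟨_, ⟨u, hu, rfl⟩, z, hz, rfl⟩ := hy
  obtain ⟨r, hr⟩ := hg.exists_eq_coe hu
  obtain ⟨s, hs⟩ := hf.exists_eq_coe hz
  obtain ⟨n, hn⟩ := exists_nat_ge (max ‖u‖ (max r s))
  simp only [max_le_iff] at hn
  refine ⟨n, u, hn.1, ?_, ?_⟩
  · rw [hr]
    exact EReal.coe_le_coe_iff.2 hn.2.1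
  · rw [sub_sub_cancel, hs]
    exact EReal.coe_le_coe_iff.2 hn.2.2

/-- Baire's theorem makes the perturbed primal values bounded above near `0`. -/
theorem exists_zero_mem_interior_perturbSet [CompleteSpace H₁] [CompleteSpace H₂]
    (hg : ProperConvexLsc g) (hf : ProperConvexLsc f)
    (h : (0 : H₂) ∈ interior (L '' dom g - dom f)) :
    ∃ n : ℝ, (0 : H₂) ∈ interior (perturbSet g f L n) := by
  have h0 : ∀ᶠ y in 𝓝 (0 : H₂), y ∈ L '' dom g - dom f := mem_interior_iff_mem_nhds.1 h
  have hscale : ∀ y : H₂, Tendsto (fun t : ℝ => t • y) (𝓝 0) (𝓝 0) := fun y => by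
    have : Continuous fun t : ℝ => t • y := by fun_prop
    simpa using this.tendsto 0
  let S : ℕ × ℕ → Set H₂ := fun q => (fun y => ((q.1 : ℝ) + 1)⁻¹ • y) ⁻¹' perturbSet g f L q.2
  have hSc : ∀ q, IsClosed (S q) := fun q =>
    (isClosed_perturbSet hg hf _).preimage (continuous_const_smul _)
  have hSu : ⋃ q, S q = univ := by
    refine eq_univ_of_forall fun y => ?_
    have ht : Tendsto (fun m : ℕ => ((m : ℝ) + 1)⁻¹) atTop (𝓝 0) := by
      simpa [one_div] using tendsto_one_div_add_atTop_nhds_zero_nat (𝕜 := ℝ)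
    obtain ⟨m, hm⟩ := (((hscale y).comp ht).eventually h0).exists
    obtain ⟨n, hn⟩ := exists_mem_perturbSet hg hf hm
    exact mem_iUnion.2 ⟨(m, n), hn⟩
  obtain ⟨⟨m, n⟩, hmn⟩ := nonempty_interior_of_iUnion_of_closed hSc hSu
  obtain ⟨y, hy⟩ : (interior (perturbSet g f L n)).Nonempty := by
    have hne : ((m : ℝ) + 1)⁻¹ ≠ 0 := by positivity
    have := (Homeomorph.smulOfNeZero (α := H₂) ((m : ℝ) + 1)⁻¹ hne).preimage_interior
      (perturbSet g f L n)
    obtain ⟨y, hy⟩ := hmn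
    change y ∈ interior (_ ⁻¹' _) at hy
    exact ⟨_, (this.symm.subset hy : y ∈ _ ⁻¹' _)⟩
  -- The interior is moved to `0`, a convex combination of the interior point `y` and the point `-δ
  -- y` of a larger set.
  obtain ⟨δ, hδ, hδ0⟩ : ∃ δ : ℝ, (-δ) • y ∈ L '' dom g - dom f ∧ 0 < δ := by
    have hneg : Tendsto (fun t : ℝ => -t) (𝓝[>] 0) (𝓝 0) := by
      have : Tendsto (fun t : ℝ => -t) (𝓝 0) (𝓝 (-0)) := tendsto_neg 0
      rw [neg_zero] at this
      exact this.mono_left nhdsWithin_le_nhds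
    exact ((((hscale y).comp hneg).eventually h0).and self_mem_nhdsWithin).exists
  obtain ⟨k, hk⟩ := exists_mem_perturbSet hg hf hδ
  refine ⟨max n k, ?_⟩
  have h1 : y ∈ interior (perturbSet g f L (max n k)) :=
    interior_mono (perturbSet_mono (le_max_left _ _)) hy
  have h2 := perturbSet_mono (le_max_right (n : ℝ) k) hk
  have h3 := (convex_perturbSet hg hf (max n k : ℝ)).combo_interior_self_mem_interior h1 h2
    (show 0 < δ / (1 + δ) by positivity) (show 0 ≤ 1 / (1 + δ) by positivity)
    (by field_simp; ring)
  have h4 : (δ / (1 + δ)) • y + (1 / (1 + δ)) • (-δ) • y = 0 := by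
    rw [smul_smul, ← add_smul]
    have : δ / (1 + δ) + 1 / (1 + δ) * -δ = 0 := by ring
    rw [this, zero_smul]
  rwa [h4] at h3

/-- Under the regularity condition every primal solution belongs to a KKT pair. -/
theorem exists_isKKT [CompleteSpace H₁] [CompleteSpace H₂]
    (hg : ProperConvexLsc g) (hf : ProperConvexLsc f) (hreg : Regularity g f L)
    {u : H₁} (hu : IsSolution (primalObj g f L) u) : ∃ p, IsKKT g f L u p := by
  obtain ⟨n, hn⟩ := exists_zero_mem_interior_perturbSet hg hf hreg.zero_mem_interior
  have hgu : g u < ⊤ := by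
    refine lt_top_iff_ne_top.2 fun h => ?_
    have := hu.1
    rw [primalObj, h, EReal.top_add_of_ne_bot (hf.ne_bot _)] at this
    exact lt_irrefl _ this
  have hfu : f (L u) < ⊤ := by
    refine lt_top_iff_ne_top.2 fun h => ?_
    have := hu.1
    rw [primalObj, h, EReal.add_top_of_ne_bot (hg.ne_bot _)] at this
    exact lt_irrefl _ this
  obtain ⟨r, hr⟩ := hg.exists_eq_coe hgu
  obtain ⟨s, hs⟩ := hf.exists_eq_coe hfu
  -- Essentially the epigraph of the perturbed optimal value; the multiplier is the slope of a
  -- hyperplane supporting it at `(0, r + s)`.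
  let A : Set (H₂ × ℝ) := {q | ∃ v, ∃ a b : ℝ, g v ≤ a ∧ f (L v - q.1) ≤ b ∧ a + b ≤ q.2}
  have hA : Convex ℝ A := by
    refine convex_iff_forall_pos.2 ?_
    rintro ⟨y, t⟩ ⟨v, a, b, h1, h2, h3⟩ ⟨y', t'⟩ ⟨v', a', b', h1', h2', h3'⟩ c e hc he hce
    refine ⟨c • v + e • v', _, c * b + e * b', hg.combo_le h1 h1' hc he hce, ?_, ?_⟩
    · have h : L (c • v + e • v') - (c • (y, t) + e • (y', t')).1 =
          c • (L v - y) + e • (L v' - y') := by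
        simp only [map_add, map_smul, Prod.fst_add, Prod.smul_fst]
        module
      rw [h]
      exact hf.combo_le h2 h2' hc he hce
    · simp only [Prod.snd_add, Prod.smul_snd, smul_eq_mul] at h3 h3' ⊢
      nlinarith
  have hAlow : ∀ t : ℝ, ((0 : H₂), t) ∈ A → r + s ≤ t := by
    rintro t ⟨v, a, b, h1, h2, h3⟩
    have h4 := hu.2 (mem_univ v)
    rw [mem_ofPred_eq, primalObj, primalObj, hr, hs] at h4
    simp only [sub_zero] at h2
    have h5 := h4.trans (add_le_add h1 h2)
    rw [← EReal.coe_add, ← EReal.coe_add, EReal.coe_le_coe_iff] at h5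
    exact h5.trans h3
  have hAint : (interior A).Nonempty := by
    refine ⟨((0 : H₂), 2 * n + 1), ?_⟩
    rw [mem_interior_iff_mem_nhds]
    refine mem_of_superset (prod_mem_nhds (mem_interior_iff_mem_nhds.1 hn)
      (Ioi_mem_nhds (show 2 * n < 2 * n + 1 by linarith))) ?_
    rintro ⟨y, t⟩ ⟨⟨v, -, h2, h3⟩, ht⟩
    have ht : 2 * n < t := ht
    exact ⟨v, n, n, h2, h3, by simp only; linarith⟩
  have hnot : ((0 : H₂), r + s) ∉ interior A := by
    intro h
    have hcont : Tendsto (fun t : ℝ => ((0 : H₂), t)) (𝓝 (r + s)) (𝓝 ((0 : H₂), r + s)) :=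
      (Continuous.prodMk_right (0 : H₂)).tendsto _
    have hev := hcont.eventually (mem_interior_iff_mem_nhds.1 h)
    obtain ⟨t, ht, htlt⟩ := ((hev.filter_mono nhdsWithin_le_nhds).and
      (self_mem_nhdsWithin (s := Iio (r + s)))).exists
    exact absurd (hAlow t ht) (not_le.2 htlt)
  obtain ⟨φ, hφ0, hφ⟩ := geometric_hahn_banach_of_nonempty_interior_point hA hnot hAint
  set σ : ℝ := φ (0, 1) with hσ
  have hdecomp : ∀ (y : H₂) (t : ℝ), φ (y, t) = φ (y, 0) + t * σ := by
    intro y t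
    rw [hσ, ← smul_eq_mul, ← map_smul, ← map_add]
    simp
  have hmem : ∀ v z (a b : ℝ), g v ≤ a → f z ≤ b → (L v - z, a + b) ∈ A := fun v z a b h1 h2 =>
    ⟨v, a, b, h1, by simpa using h2, le_rfl⟩
  have hσ0 : σ ≤ 0 := by
    have h1 := hφ _ (hmem u (L u) (r + 1) s
      (by rw [hr]; exact EReal.coe_le_coe_iff.2 (by linarith)) hs.le)
    rw [sub_self, hdecomp, hdecomp 0 (r + s)] at h1
    linarith
  -- A vertical hyperplane would make `φ (·, 0)` nonpositive near `0`, hence zero everywhere by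
  -- scaling and symmetry.
  have hσne : σ ≠ 0 := by
    intro h
    have hle : ∀ y ∈ perturbSet g f L n, φ (y, 0) ≤ 0 := by
      rintro y ⟨v, -, h2, h3⟩
      have h4 := hφ (y, n + n) ⟨v, n, n, h2, h3, le_rfl⟩
      have h5 : φ ((0 : H₂), (0 : ℝ)) = 0 := map_zero φ
      rw [hdecomp, hdecomp 0 (r + s), h, h5] at h4
      linarith
    have hzero : ∀ y : H₂, φ (y, 0) ≤ 0 := by
      intro y
      have hsc : Tendsto (fun t : ℝ => t • y) (𝓝[>] 0) (𝓝 0) := by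
        have : Continuous fun t : ℝ => t • y := by fun_prop
        exact (by simpa using this.tendsto 0 : Tendsto (fun t : ℝ => t • y) (𝓝 0) (𝓝 0)).mono_left
          nhdsWithin_le_nhds
      obtain ⟨t, ht, ht0⟩ := ((hsc.eventually (mem_interior_iff_mem_nhds.1 hn)).and
        self_mem_nhdsWithin).exists
      have h1 := hle _ ht
      have h2 : φ (t • y, 0) = t * φ (y, 0) := by
        rw [← smul_eq_mul, ← map_smul]
        simp
      rw [h2] at h1
      exact nonpos_of_mul_nonpos_right h1 ht0
    refine hφ0 (ContinuousLinearMap.ext fun q => ?_)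
    have h1 := hzero q.1
    have h2 := hzero (-q.1)
    have h3 : φ (-q.1, 0) = -φ (q.1, 0) := by
      rw [← map_neg]
      simp
    have h4 := hdecomp q.1 q.2
    rw [h, mul_zero, add_zero] at h4
    change φ (q.1, q.2) = 0
    linarith
  have hσneg : σ < 0 := lt_of_le_of_ne hσ0 hσne
  obtain ⟨w, hw⟩ := (InnerProductSpace.toDual ℝ H₂).surjective
    (φ.comp (ContinuousLinearMap.inl ℝ H₂ ℝ))
  have hw' : ∀ y, φ (y, 0) = inner ℝ w y := fun y => by
    rw [← InnerProductSpace.toDual_apply_apply (𝕜 := ℝ), hw]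
    simp
  have key : ∀ v z (a b : ℝ), g v ≤ a → f z ≤ b →
      r + s + inner ℝ ((-σ)⁻¹ • w) (L v - z) ≤ a + b := by
    intro v z a b h1 h2
    have h3 := hφ _ (hmem v z a b h1 h2)
    rw [hdecomp, hdecomp 0 (r + s), hw', hw', inner_zero_right] at h3
    rw [real_inner_smul_left]
    have h4 : (-σ)⁻¹ * inner ℝ w (L v - z) ≤ (-σ)⁻¹ * ((-σ) * (a + b - (r + s))) :=
      mul_le_mul_of_nonneg_left (by linarith) (inv_nonneg.2 (by linarith))
    rw [inv_mul_cancel_left₀ (by linarith)] at h4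
    linarith
  refine ⟨-((-σ)⁻¹ • w), ⟨r, hr, fun y t hy => ?_⟩, ⟨s, hs, fun z t hz => ?_⟩⟩
  · have := key y (L u) t s hy hs.le
    rw [neg_neg]
    linarith
  · have := key u z r t hr.le hz
    rw [← neg_sub, inner_neg_right] at this
    simp only [ContinuousLinearMap.id_apply]
    rw [inner_neg_left]
    linarith

end Duality

/-! ### Perturbed Fejér monotonicity and Opial's argument. -/

section QuasiFejer

/-- Subtracting the partial sums of `e` leaves a decreasing sequence bounded below. -/
theorem exists_tendsto_of_succ_le_add {a e : ℕ → ℝ} (ha : ∀ k, 0 ≤ a k) (he : ∀ k, 0 ≤ e k)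
    (hes : Summable e) (h : ∀ k, a (k + 1) ≤ a k + e k) : ∃ t, Tendsto a atTop (𝓝 t) := by
  let c : ℕ → ℝ := fun k => a k - ∑ j ∈ Finset.range k, e j
  have hc : Antitone c := antitone_nat_of_succ_le fun k => by
    simp only [c, Finset.sum_range_succ]
    linarith [h k]
  have hbd : BddBelow (range c) := by
    refine ⟨-∑' j, e j, ?_⟩
    rintro _ ⟨k, rfl⟩
    have h1 := hes.sum_le_tsum (Finset.range k) fun j _ => he j
    simp only [c]
    linarith [ha k]
  refine ⟨_, ((tendsto_atTop_ciInf hc hbd).add hes.hasSum.tendsto_sum_nat).congr fun k => ?_⟩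
  simp only [c]
  ring

/-- Summability of the decrements of a perturbed Fejér sequence. -/
theorem summable_of_quasiFejer {a a' w e : ℕ → ℝ} (ha : ∀ k, 0 ≤ a k)
    (hw : ∀ k, 0 ≤ w k) (he : ∀ k, 0 ≤ e k) (hes : Summable e)
    (h : ∀ k, a' k ^ 2 + w k ≤ a k ^ 2) (h' : ∀ k, a (k + 1) ≤ a' k + e k) :
    (∃ t, Tendsto a atTop (𝓝 t)) ∧ Summable w := by
  have hle : ∀ k, a' k ≤ a k := fun k =>
    le_of_sq_le_sq (by linarith [h k, hw k]) (ha k)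
  have hlim := exists_tendsto_of_succ_le_add ha he hes fun k => by linarith [h' k, hle k]
  refine ⟨hlim, ?_⟩
  obtain ⟨t, ht⟩ := hlim
  obtain ⟨B, hB⟩ := ht.bddAbove_range
  have hB : ∀ k, a k ≤ B := fun k => hB (mem_range_self k)
  have hB0 : 0 ≤ B := (ha 0).trans (hB 0)
  set E := ∑' j, e j with hE
  have hE0 : 0 ≤ E := tsum_nonneg he
  have heE : ∀ k, e k ≤ E := fun k => hes.le_tsum k fun j _ => he j
  have hstep : ∀ k, w k ≤ a k ^ 2 - a (k + 1) ^ 2 + e k * (2 * B + E) := by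
    intro k
    have h1 : a (k + 1) ^ 2 ≤ (a' k + e k) ^ 2 := pow_le_pow_left₀ (ha _) (h' k) 2
    have h2 : e k * (2 * a' k + e k) ≤ e k * (2 * B + E) :=
      mul_le_mul_of_nonneg_left (by linarith [hle k, hB k, heE k]) (he k)
    nlinarith [h k]
  refine summable_of_sum_range_le hw (c := a 0 ^ 2 + E * (2 * B + E)) fun n => ?_
  have h1 : ∑ k ∈ Finset.range n, w k ≤
      a 0 ^ 2 - a n ^ 2 + (∑ k ∈ Finset.range n, e k) * (2 * B + E) := by
    induction n with
    | zero => simp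
    | succ n ih =>
      rw [Finset.sum_range_succ, Finset.sum_range_succ, add_mul]
      linarith [hstep n]
  have h2 : (∑ k ∈ Finset.range n, e k) * (2 * B + E) ≤ E * (2 * B + E) :=
    mul_le_mul_of_nonneg_right (hes.sum_le_tsum _ fun j _ => he j) (by positivity)
  linarith [sq_nonneg (a n)]

/-- Opial's argument: weak limit points of a sequence whose distances to them converge agree. -/
theorem WTendsto.eq_of_tendsto_norm_sub {ι H : Type*} [NormedAddCommGroup H] [InnerProductSpace ℝ H]
    {s : ι → H} {l l₁ l₂ : Filter ι} [l₁.NeBot] [l₂.NeBot] (h₁ : l₁ ≤ l) (h₂ : l₂ ≤ l) {x y : H}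
    {t t' : ℝ} (hx : WTendsto s l₁ x) (hy : WTendsto s l₂ y)
    (ht : Tendsto (fun i => ‖s i - x‖) l (𝓝 t)) (ht' : Tendsto (fun i => ‖s i - y‖) l (𝓝 t')) :
    x = y := by
  -- This inner product is an affine function of the two squared distances, so it has one limit
  -- along all of `l`.
  have hlim : Tendsto (fun i => inner ℝ (s i) (y - x)) l
      (𝓝 ((t ^ 2 - t' ^ 2 - ‖x‖ ^ 2 + ‖y‖ ^ 2) / 2)) := by
    refine (((((ht.pow 2).sub (ht'.pow 2)).sub_const (‖x‖ ^ 2)).add_const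
      (‖y‖ ^ 2)).div_const 2).congr fun i => ?_
    rw [norm_sub_sq_real, norm_sub_sq_real, inner_sub_right]
    ring
  have h := (tendsto_nhds_unique (hx (y - x)) (hlim.mono_left h₁)).trans
    (tendsto_nhds_unique (hy (y - x)) (hlim.mono_left h₂)).symm
  rw [← sub_eq_zero, ← inner_sub_left, ← neg_sub, inner_neg_left, neg_eq_zero,
    inner_self_eq_zero, sub_eq_zero] at h
  exact h.symm

end QuasiFejer

/-! ### The inexact Douglas-Rachford iteration. -/

section DouglasRachford

variable {H₁ H₂ : Type*} [NormedAddCommGroup H₁] [InnerProductSpace ℝ H₁]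
  [NormedAddCommGroup H₂] [InnerProductSpace ℝ H₂]
  {g : H₁ → EReal} {f : H₂ → EReal} {L : H₁ →L[ℝ] H₂} {lam : ℝ}

theorem IsKKT.subgradAt_left {z : H₁} {w : H₂} (h : IsKKT g f L z (lam • w)) :
    SubgradAt g L z (lam • ((L z - w) - L z)) := by
  simpa using h.1

theorem IsKKT.subgradAt_right {z : H₁} {w : H₂} (h : IsKKT g f L z (lam • w)) :
    SubgradAt f (.id ℝ H₂) (L z) (lam • ((L z + w) - ContinuousLinearMap.id ℝ H₂ (L z))) := by
  simpa using h.2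

/-- One Douglas-Rachford step is Fejér monotone with respect to KKT pairs. -/
theorem IsKKT.fejer (hlam : 0 < lam) {z : H₁} {w : H₂} (h : IsKKT g f L z (lam • w)) {s p : H₂}
    {v : H₁} (hp : SubgradAt f (.id ℝ H₂) p (lam • (s - p)))
    (hv : SubgradAt g L v (lam • (((2 : ℝ) • p - s) - L v))) :
    ‖s - p + L v - (L z + w)‖ ^ 2 + ‖p - L v‖ ^ 2 ≤ ‖s - (L z + w)‖ ^ 2 := by
  have h1 := SubgradAt.norm_sq_le hlam hp h.subgradAt_right
  have h2 := SubgradAt.norm_sq_le hlam hv h.subgradAt_left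
  simp only [ContinuousLinearMap.id_apply] at h1
  -- In these variables the claim is twice the sum of `h1` and `h2`.
  set S := s - (L z + w) with hS
  set P := p - L z with hP
  set Q := L v - L z with hQ
  have e1 : (2 : ℝ) • p - s - (L z - w) = (2 : ℝ) • P - S := by
    rw [hS, hP]
    module
  have e2 : s - p + L v - (L z + w) = S + (Q - P) := by
    rw [hS, hP, hQ]
    abel
  have e3 : p - L v = -(Q - P) := by
    rw [hP, hQ]
    abel
  rw [e1, inner_sub_left, real_inner_smul_left] at h2
  rw [e2, e3, norm_neg, norm_add_sq_real, norm_sub_sq_real Q P, inner_sub_right,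
    real_inner_comm P Q]
  linarith

/-- Weak limits of Douglas-Rachford steps with vanishing residual are KKT pairs. -/
theorem isKKT_of_wTendsto [CompleteSpace H₁] [CompleteSpace H₂] {ι : Type*} (hg : ProperConvexLsc g)
    (hf : ProperConvexLsc f) {U : Ultrafilter ι} {s p : ι → H₂} {v : ι → H₁}
    (hp : ∀ k, SubgradAt f (.id ℝ H₂) (p k) (lam • (s k - p k)))
    (hv : ∀ k, SubgradAt g L (v k) (lam • (((2 : ℝ) • p k - s k) - L (v k))))
    {B : ℝ} (hsB : ∀ k, ‖s k‖ ≤ B) (hpB : ∀ k, ‖p k‖ ≤ B) (hvB : ∀ k, ‖v k‖ ≤ B)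
    (hres : Tendsto (fun k => p k - L (v k)) U (𝓝 0))
    {σ : H₂} {z : H₁} (hs : WTendsto s U σ) (hz : WTendsto v U z) :
    IsKKT g f L z (lam • (σ - L z)) := by
  choose r hr hrp using hp
  choose r' hr' hrv using hv
  have hpz : WTendsto p U (L z) := (hz.map L).of_sub_tendsto_zero hres
  have hLv : ∀ k, ‖L (v k)‖ ≤ ‖L‖ * B := fun k =>
    (L.le_opNorm _).trans (mul_le_mul_of_nonneg_left (hvB k) (norm_nonneg _))
  -- Adding the two subgradient inequalities cures products of merely weakly convergent sequences:
  -- they regroup against `p k - L (v k)`, which tends to `0` in norm.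
  let θ : H₂ → H₁ → ι → ℝ := fun y y' k =>
    inner ℝ (s k - p k) (y - L y') + inner ℝ (p k - L (v k)) (L y' - L (v k) - (s k - p k))
  have hθ : ∀ y y', Tendsto (θ y y') U (𝓝 (inner ℝ (σ - L z) (y - L y'))) := by
    intro y y'
    have h0 : Tendsto (fun k => inner ℝ (p k - L (v k)) (L y' - L (v k) - (s k - p k))) U (𝓝 0) := by
      have hb : Tendsto (fun k => ‖p k - L (v k)‖ * (‖L y'‖ + ‖L‖ * B + (B + B))) U (𝓝 0) := by
        simpa using hres.norm.mul_const (‖L y'‖ + ‖L‖ * B + (B + B))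
      refine squeeze_zero_norm (fun k => (norm_inner_le_norm _ _).trans ?_) hb
      refine mul_le_mul_of_nonneg_left ?_ (norm_nonneg _)
      refine (norm_sub_le _ _).trans (add_le_add ((norm_sub_le _ _).trans ?_)
        ((norm_sub_le _ _).trans (add_le_add (hsB k) (hpB k))))
      linarith [hLv k]
    simpa using ((hs.sub hpz) (y - L y')).add h0
  have hsum : ∀ y y' (t t' : ℝ), f y ≤ t → g y' ≤ t' →
      ∀ k, r k + r' k + lam * θ y y' k ≤ t + t' := by
    intro y y' t t' hy hy' k
    have h1 := hrp k y t hy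
    have h2 := hrv k y' t' hy'
    have e : (2 : ℝ) • p k - s k - L (v k) = (p k - L (v k)) - (s k - p k) := by module
    rw [real_inner_smul_left] at h1 h2
    simp only [ContinuousLinearMap.id_apply] at h1
    rw [e] at h2
    have e' : θ y y' k = inner ℝ (s k - p k) (y - p k) +
        inner ℝ (p k - L (v k) - (s k - p k)) (L y' - L (v k)) := by
      simp only [θ, inner_sub_left, inner_sub_right]
      rw [real_inner_comm (L (v k)) (p k), real_inner_comm (L (v k)) (s k),
        real_inner_comm (p k) (s k)]
      ring
    rw [e', mul_add]
    linarith
  obtain ⟨y₀, hy₀⟩ := hf.dom_nonempty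
  obtain ⟨t₀, ht₀⟩ := hf.exists_eq_coe hy₀
  obtain ⟨x₀, hx₀⟩ := hg.dom_nonempty
  obtain ⟨t₁, ht₁⟩ := hg.exists_eq_coe hx₀
  obtain ⟨A, C, hC, hA⟩ := hf.exists_linear_minorant
  obtain ⟨A', C', hC', hA'⟩ := hg.exists_linear_minorant
  have hlow : ∀ k, A - C * B ≤ r k := fun k => by
    linarith [hA (p k) (r k) (hr k).le, mul_le_mul_of_nonneg_left (hpB k) hC]
  have hlow' : ∀ k, A' - C' * B ≤ r' k := fun k => by
    linarith [hA' (v k) (r' k) (hr' k).le, mul_le_mul_of_nonneg_left (hvB k) hC']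
  have hθlow := ((hθ y₀ x₀).const_mul lam).eventually_const_lt (sub_one_lt _)
  set N := t₀ + t₁ - (lam * inner ℝ (σ - L z) (y₀ - L x₀) - 1) with hN
  -- With the linear minorants, this bounds each of `r` and `r'`, so both converge along `U`.
  have hup : ∀ᶠ k in (U : Filter ι), r k + r' k ≤ N := by
    filter_upwards [hθlow] with k hk
    linarith [hsum y₀ x₀ t₀ t₁ ht₀.le ht₁.le k]
  obtain ⟨ρ, hρ⟩ := exists_tendsto_of_bounded U (x := r)
    (B := max (-(A - C * B)) (N - (A' - C' * B))) (hup.mono fun k hk => by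
      rw [abs_le, neg_le, le_max_iff, le_max_iff]
      exact ⟨Or.inl (by linarith [hlow k]), Or.inr (by linarith [hlow' k])⟩)
  obtain ⟨ρ', hρ'⟩ := exists_tendsto_of_bounded U (x := r')
    (B := max (-(A' - C' * B)) (N - (A - C * B))) (hup.mono fun k hk => by
      rw [abs_le, neg_le, le_max_iff, le_max_iff]
      exact ⟨Or.inl (by linarith [hlow' k]), Or.inr (by linarith [hlow k])⟩)
  have hfz : f (L z) ≤ ρ := hf.le_of_wTendsto hpz hρ (.of_forall fun k => (hr k).le)
  have hgz : g z ≤ ρ' := hg.le_of_wTendsto hz hρ' (.of_forall fun k => (hr' k).le)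
  obtain ⟨φ, hφ⟩ := hf.exists_eq_coe (hfz.trans_lt (EReal.coe_lt_top _))
  obtain ⟨γ, hγ⟩ := hg.exists_eq_coe (hgz.trans_lt (EReal.coe_lt_top _))
  have hφρ : φ ≤ ρ := by rwa [hφ, EReal.coe_le_coe_iff] at hfz
  have hγρ : γ ≤ ρ' := by rwa [hγ, EReal.coe_le_coe_iff] at hgz
  have key : ∀ y y' (t t' : ℝ), f y ≤ t → g y' ≤ t' →
      ρ + ρ' + lam * inner ℝ (σ - L z) (y - L y') ≤ t + t' := fun y y' t t' hy hy' =>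
    le_of_tendsto' ((hρ.add hρ').add ((hθ y y').const_mul lam)) (hsum y y' t t' hy hy')
  -- Testing `key` with one argument at the limit point decouples the sum, thanks to `φ ≤ ρ` and `γ
  -- ≤ ρ'`.
  refine ⟨⟨γ, hγ, fun y t hy => ?_⟩, ⟨φ, hφ, fun y t hy => ?_⟩⟩
  · have := key (L z) y φ t hφ.le hy
    rw [← neg_sub (L y), inner_neg_right] at this
    rw [inner_neg_left, real_inner_smul_left]
    linarith
  · have := key y z t γ hy hγ.le
    rw [real_inner_smul_left]
    simp only [ContinuousLinearMap.id_apply]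
    linarith

/-- Weak convergence of the inexact Douglas-Rachford iteration together with its shadow sequence. -/
theorem exists_isKKT_wTendsto [CompleteSpace H₁] [CompleteSpace H₂] (hg : ProperConvexLsc g)
    (hf : ProperConvexLsc f) (hlam : 0 < lam) {κ : ℝ} (hκ : 0 ≤ κ) (hL : ∀ x, ‖x‖ ≤ κ * ‖L x‖)
    (hkkt : ∃ z q, IsKKT g f L z q) {s p : ℕ → H₂} {v : ℕ → H₁}
    (hp : ∀ k, SubgradAt f (.id ℝ H₂) (p k) (lam • (s k - p k)))
    (hv : ∀ k, SubgradAt g L (v k) (lam • (((2 : ℝ) • p k - s k) - L (v k))))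
    {e : ℕ → ℝ} (hes : Summable e) (hs : ∀ k, ‖s (k + 1) - (s k - p k + L (v k))‖ ≤ e k) :
    Summable (fun k => ‖p k - L (v k)‖ ^ 2) ∧ ∃ z w, IsKKT g f L z (lam • w) ∧
      WTendsto s atTop (L z + w) ∧ WTendsto p atTop (L z) := by
  have he : ∀ k, 0 ≤ e k := fun k => (norm_nonneg _).trans (hs k)
  have hfejer : ∀ z w, IsKKT g f L z (lam • w) →
      (∃ t, Tendsto (fun k => ‖s k - (L z + w)‖) atTop (𝓝 t)) ∧
        Summable (fun k => ‖p k - L (v k)‖ ^ 2) := by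
    intro z w h
    refine summable_of_quasiFejer (a' := fun k => ‖s k - p k + L (v k) - (L z + w)‖)
      (fun _ => norm_nonneg _) (fun _ => sq_nonneg _) he hes
      (fun k => h.fejer hlam (hp k) (hv k)) fun k => ?_
    have h1 := norm_add_le (s k - p k + L (v k) - (L z + w)) (s (k + 1) - (s k - p k + L (v k)))
    have h2 : s k - p k + L (v k) - (L z + w) + (s (k + 1) - (s k - p k + L (v k))) =
        s (k + 1) - (L z + w) := by abel
    rw [h2] at h1
    linarith [hs k]
  obtain ⟨z₀, q₀, h₀⟩ := hkkt
  obtain ⟨w₀, rfl⟩ : ∃ w₀ : H₂, q₀ = lam • w₀ := ⟨lam⁻¹ • q₀, (smul_inv_smul₀ hlam.ne' q₀).symm⟩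
  obtain ⟨⟨t₀, ht₀⟩, hsummable⟩ := hfejer z₀ w₀ h₀
  refine ⟨hsummable, ?_⟩
  have hres : Tendsto (fun k => p k - L (v k)) atTop (𝓝 0) := by
    rw [tendsto_zero_iff_norm_tendsto_zero]
    simpa using (hsummable.tendsto_atTop_zero).sqrt
  obtain ⟨B₀, hB₀⟩ := ht₀.bddAbove_range
  have hB₀ : ∀ k, ‖s k - (L z₀ + w₀)‖ ≤ B₀ := fun k => hB₀ (mem_range_self k)
  have hpB : ∀ k, ‖p k - L z₀‖ ≤ B₀ := fun k =>
    (SubgradAt.norm_le hlam (hp k) h₀.subgradAt_right).trans (hB₀ k)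
  have hvB : ∀ k, ‖L (v k) - L z₀‖ ≤ 2 * B₀ + B₀ := by
    intro k
    refine (SubgradAt.norm_le hlam (hv k) h₀.subgradAt_left).trans ?_
    have e1 : (2 : ℝ) • p k - s k - (L z₀ - w₀) =
        (2 : ℝ) • (p k - L z₀) - (s k - (L z₀ + w₀)) := by module
    rw [e1]
    refine (norm_sub_le _ _).trans (add_le_add ?_ (hB₀ k))
    rw [norm_smul, Real.norm_of_nonneg zero_le_two]
    exact mul_le_mul_of_nonneg_left (hpB k) zero_le_two
  have norm_le_of_sub : ∀ {x y : H₂} {c : ℝ}, ‖x - y‖ ≤ c → ‖x‖ ≤ c + ‖y‖ := fun {x y c} h => by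
    have := norm_add_le (x - y) y
    rw [sub_add_cancel] at this
    linarith
  obtain ⟨B, hsB, hpB', hvB'⟩ : ∃ B, (∀ k, ‖s k‖ ≤ B) ∧ (∀ k, ‖p k‖ ≤ B) ∧ ∀ k, ‖v k‖ ≤ B := by
    refine ⟨max (B₀ + ‖L z₀ + w₀‖) (max (B₀ + ‖L z₀‖) (κ * (2 * B₀ + B₀ + ‖L z₀‖))),
      fun k => ?_, fun k => ?_, fun k => ?_⟩
    · exact le_max_of_le_left (norm_le_of_sub (hB₀ k))
    · exact le_max_of_le_right (le_max_of_le_left (norm_le_of_sub (hpB k)))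
    · exact le_max_of_le_right (le_max_of_le_right ((hL _).trans
        (mul_le_mul_of_nonneg_left (norm_le_of_sub (hvB k)) hκ)))
  have hlimit : ∀ U : Ultrafilter ℕ, ↑U ≤ (atTop : Filter ℕ) → ∃ z w, IsKKT g f L z (lam • w) ∧
      WTendsto s U (L z + w) ∧ WTendsto p U (L z) := by
    intro U hU
    obtain ⟨σ, hσ⟩ := exists_wTendsto_of_bounded U (.of_forall hsB)
    obtain ⟨z, hz⟩ := exists_wTendsto_of_bounded U (.of_forall hvB')
    refine ⟨z, σ - L z, isKKT_of_wTendsto hg hf hp hv hsB hpB' hvB' (hres.mono_left hU) hσ hz,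
      by simpa using hσ, (hz.map L).of_sub_tendsto_zero (hres.mono_left hU)⟩
  have hU₀ : ((hyperfilter ℕ : Ultrafilter ℕ) : Filter ℕ) ≤ atTop := by
    rw [← Nat.cofinite_eq_atTop]
    exact hyperfilter_le_cofinite
  obtain ⟨z, w, hzw, hszw, hpz⟩ := hlimit _ hU₀
  have hunique : ∀ U : Ultrafilter ℕ, ↑U ≤ (atTop : Filter ℕ) →
      WTendsto s U (L z + w) ∧ WTendsto p U (L z) := by
    intro U hU
    obtain ⟨z', w', hzw', hszw', hpz'⟩ := hlimit U hU
    obtain ⟨⟨t, ht⟩, -⟩ := hfejer z w hzw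
    obtain ⟨⟨t', ht'⟩, -⟩ := hfejer z' w' hzw'
    have h1 : L z + w = L z' + w' := hszw.eq_of_tendsto_norm_sub hU₀ hU hszw' ht ht'
    -- `L z` is the proximal point of `f` at `L z + w`, so equal sums force equal `L z`.
    have h2 := SubgradAt.norm_le hlam hzw.subgradAt_right hzw'.subgradAt_right
    rw [h1, sub_self, norm_zero] at h2
    have h3 : L z = L z' := sub_eq_zero.1 (norm_le_zero_iff.1 h2)
    rw [h1, h3]
    exact ⟨hszw', hpz'⟩
  exact ⟨z, w, hzw, .of_ultrafilter fun U hU => (hunique U hU).1,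
    .of_ultrafilter fun U hU => (hunique U hU).2⟩

end DouglasRachford

/-! ### Reduction of the split Bregman algorithm to Douglas-Rachford. -/

section Algorithm

variable {H₁ H₂ : Type*} [NormedAddCommGroup H₁] [InnerProductSpace ℝ H₁]
  [NormedAddCommGroup H₂] [InnerProductSpace ℝ H₂]
  {g : H₁ → EReal} {f : H₂ → EReal} {L : H₁ →L[ℝ] H₂} {lam : ℝ}

/-- If `L* L` is surjective then `L` is bounded below. -/
theorem exists_norm_le_of_surjective [CompleteSpace H₁] [CompleteSpace H₂]
    (hL : Function.Surjective (fun u : H₁ => ContinuousLinearMap.adjoint L (L u))) :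
    ∃ κ : ℝ, 0 ≤ κ ∧ ∀ x, ‖x‖ ≤ κ * ‖L x‖ := by
  let T : H₁ →L[ℝ] H₁ := (ContinuousLinearMap.adjoint L).comp L
  -- `T` is self-adjoint and onto: if `T x = 0` and `x = T y`, then `⟨x, x⟩ = ⟨y, T x⟩ = 0`.
  have hker : T.ker = ⊥ := by
    refine LinearMap.ker_eq_bot'.2 fun x hx => ?_
    obtain ⟨y, hy⟩ := hL x
    have hx : ContinuousLinearMap.adjoint L (L x) = 0 := hx
    rw [← inner_self_eq_zero (𝕜 := ℝ)]
    nth_rw 1 [← hy]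
    simp only [ContinuousLinearMap.adjoint_inner_left]
    rw [← ContinuousLinearMap.adjoint_inner_right, hx, inner_zero_right]
  have hrange : T.range = ⊤ := LinearMap.range_eq_top.2 hL
  let E := ContinuousLinearEquiv.ofBijective T hker hrange
  refine ⟨‖(E.symm : H₁ →L[ℝ] H₁)‖ * ‖ContinuousLinearMap.adjoint L‖, by positivity, fun x => ?_⟩
  have h1 : E.symm (T x) = x := E.symm_apply_apply x
  calc ‖x‖ = ‖(E.symm : H₁ →L[ℝ] H₁) (T x)‖ := by
        rw [ContinuousLinearEquiv.coe_coe, h1]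
    _ ≤ ‖(E.symm : H₁ →L[ℝ] H₁)‖ * ‖T x‖ := ContinuousLinearMap.le_opNorm _ _
    _ ≤ ‖(E.symm : H₁ →L[ℝ] H₁)‖ * (‖ContinuousLinearMap.adjoint L‖ * ‖L x‖) :=
        mul_le_mul_of_nonneg_left ((ContinuousLinearMap.adjoint L).le_opNorm (L x)) (norm_nonneg _)
    _ = _ := by ring

theorem stepOne_eq_proxObj (b d : H₂) : stepOne g L lam b d = proxObj g L lam (d - b) := by
  funext u
  rw [stepOne, proxObj, show b + L u - d = L u - (d - b) by abel]

theorem stepTwo_eq_proxObj (b : H₂) (u : H₁) :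
    stepTwo f L lam b u = proxObj f (.id ℝ H₂) lam (b + L u) := by
  funext d
  rw [stepTwo, proxObj, ContinuousLinearMap.id_apply, norm_sub_rev]

theorem ProperConvexLsc.wellDefined [CompleteSpace H₁] [CompleteSpace H₂] (hg : ProperConvexLsc g)
    (hf : ProperConvexLsc f) (hlam : 0 < lam) {κ : ℝ} (hκ : 0 ≤ κ) (hL : ∀ x, ‖x‖ ≤ κ * ‖L x‖) :
    WellDefined g f L lam := by
  refine ⟨fun b d => ?_, fun b u => ?_⟩
  · rw [stepOne_eq_proxObj]
    exact hg.exists_isMinOn_proxObj hκ hL hlam _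
  · rw [stepTwo_eq_proxObj]
    exact hf.exists_isMinOn_proxObj zero_le_one (fun x => by simp) hlam _

theorem summable_sq_of_nonneg {e : ℕ → ℝ} (he : ∀ k, 0 ≤ e k) (hes : Summable e) :
    Summable fun k => e k ^ 2 := by
  refine (hes.mul_left (∑' j, e j)).of_nonneg_of_le (fun k => sq_nonneg _) fun k => ?_
  rw [sq]
  exact mul_le_mul_of_nonneg_right (hes.le_tsum k fun j _ => he j) (he k)

theorem IsApproxRun.exists_wTendsto [CompleteSpace H₁] [CompleteSpace H₂] (hg : ProperConvexLsc g)
    (hf : ProperConvexLsc f) (hlam : 0 < lam) {κ : ℝ} (hκ : 0 ≤ κ) (hL : ∀ x, ‖x‖ ≤ κ * ‖L x‖)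
    (hkkt : ∃ z q, IsKKT g f L z q) {α β : ℕ → ℝ}
    (hsum : Summable (fun k => α (k + 1) + β (k + 1))) {u : ℕ → H₁} {d b : ℕ → H₂}
    (hrun : IsApproxRun g f L lam α β u d b) :
    Summable (fun k => ‖d k - L (u (k + 1))‖ ^ 2) ∧ ∃ z w, IsKKT g f L z (lam • w) ∧
      WTendsto d atTop (L z) ∧ WTendsto b atTop w := by
  choose uex huex hu using hrun.step_u
  choose p hp hd using hrun.step_d
  have hα0 : ∀ k, 0 ≤ α (k + 1) := fun k => (norm_nonneg _).trans (hu k)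
  have hβ0 : ∀ k, 0 ≤ β (k + 1) := fun k => (norm_nonneg _).trans (hd k)
  have hα : Summable fun k => α (k + 1) :=
    hsum.of_nonneg_of_le hα0 fun k => by linarith [hβ0 k]
  have hβ : Summable fun k => β (k + 1) :=
    hsum.of_nonneg_of_le hβ0 fun k => by linarith [hα0 k]
  let s : ℕ → H₂ := fun k => b (k + 1) + d (k + 1)
  have hsb : ∀ k, s k = b k + L (u (k + 1)) := fun k => by
    simp only [s, hrun.step_b k, sub_add_cancel]
  have hsubf : ∀ k, SubgradAt f (.id ℝ H₂) (p k) (lam • (s k - p k)) := fun k => by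
    have h := hp k
    rw [stepTwo_eq_proxObj, ← hsb] at h
    exact hf.subgradAt_of_isMinOn h
  choose v hv using fun k => hg.exists_isMinOn_proxObj hκ hL hlam ((2 : ℝ) • p k - s k)
  have hsubg := fun k => hg.subgradAt_of_isMinOn (hv k)
  have huex' : ∀ k, SubgradAt g L (uex k) (lam • ((d k - b k) - L (uex k))) := fun k => by
    have h := huex k
    rw [stepOne_eq_proxObj] at h
    exact hg.subgradAt_of_isMinOn h
  -- `α` comes from the next `u`-step. Replacing `p k` by `d (k + 1)` costs `2β` in the argument `2p
  -- - s` of the `g`-step and one more `β` in the update.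
  let e : ℕ → ℝ := fun k => α (k + 2) + 3 * β (k + 1)
  have he : ∀ k, ‖s (k + 1) - (s k - p k + L (v k))‖ ≤ e k := by
    intro k
    have h1 : ‖L (uex (k + 1)) - L (v k)‖ ≤ 2 * β (k + 1) := by
      refine (SubgradAt.norm_le hlam (huex' (k + 1)) (hsubg k)).trans ?_
      have : d (k + 1) - b (k + 1) - ((2 : ℝ) • p k - s k) = (2 : ℝ) • (d (k + 1) - p k) := by
        simp only [s]
        module
      rw [this, norm_smul, Real.norm_of_nonneg zero_le_two]
      exact mul_le_mul_of_nonneg_left (hd k) zero_le_two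
    have h2 : s (k + 1) - (s k - p k + L (v k)) = (L (u (k + 2)) - L (uex (k + 1))) +
        (L (uex (k + 1)) - L (v k)) - (d (k + 1) - p k) := by
      rw [hsb (k + 1)]
      simp only [s]
      abel
    rw [h2]
    refine (norm_sub_le _ _).trans ?_
    have h3 := norm_add_le (L (u (k + 2)) - L (uex (k + 1))) (L (uex (k + 1)) - L (v k))
    simp only [e]
    linarith [hu (k + 1), hd k]
  have hes : Summable e :=
    ((summable_nat_add_iff 1).2 hα).add (hβ.mul_left 3)
  obtain ⟨hw, z, w, hzw, hsw, hpz⟩ :=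
    exists_isKKT_wTendsto hg hf hlam hκ hL hkkt hsubf hsubg hes he
  have hdp : Tendsto (fun k => d (k + 1) - p k) atTop (𝓝 0) :=
    squeeze_zero_norm hd hβ.tendsto_atTop_zero
  have hd' : WTendsto (fun k => d (k + 1)) atTop (L z) := hpz.of_sub_tendsto_zero hdp
  have hb' : WTendsto (fun k => b (k + 1)) atTop w := by
    simpa [s] using hsw.sub hd'
  refine ⟨?_, z, w, hzw, fun y => (tendsto_add_atTop_iff_nat 1).1 (hd' y),
    fun y => (tendsto_add_atTop_iff_nat 1).1 (hb' y)⟩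
  have he0 : ∀ k, 0 ≤ e k := fun k => (norm_nonneg _).trans (he k)
  -- The term `k = 0`, which involves the arbitrary `d 0`, is dropped; the rest follows from `(x +
  -- y) ^ 2 ≤ 2 (x ^ 2 + y ^ 2)`.
  refine (summable_nat_add_iff 1).1 ((((summable_sq_of_nonneg he0 hes).add hw).mul_left
    2).of_nonneg_of_le (fun k => sq_nonneg _) fun k => ?_)
  have h1 : d (k + 1) - L (u (k + 1 + 1)) =
      (p k - L (v k)) - (s (k + 1) - (s k - p k + L (v k))) := by
    rw [hsb (k + 1)]
    simp only [s]
    abel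
  have h2 : ‖d (k + 1) - L (u (k + 1 + 1))‖ ≤ ‖p k - L (v k)‖ + e k := by
    rw [h1]
    exact (norm_sub_le _ _).trans (add_le_add_right (he k) _)
  have h3 := pow_le_pow_left₀ (norm_nonneg _) h2 2
  nlinarith [sq_nonneg (‖p k - L (v k)‖ - e k)]

end Algorithm

end SplitBregman

theorem corollary3p3 {H₁ H₂ : Type*}
    [NormedAddCommGroup H₁] [InnerProductSpace ℝ H₁] [CompleteSpace H₁]
    [NormedAddCommGroup H₂] [InnerProductSpace ℝ H₂] [CompleteSpace H₂]
    (g : H₁ → EReal) (f : H₂ → EReal) (L : H₁ →L[ℝ] H₂) (lam : ℝ)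
    (hg : SplitBregman.ProperConvexLsc g) (hf : SplitBregman.ProperConvexLsc f)
    (hlam : 0 < lam)
    (hreg : SplitBregman.Regularity g f L)
    (hP : ∃ u, SplitBregman.IsSolution (SplitBregman.primalObj g f L) u)
    (hD : ∃ p, SplitBregman.IsSolution (SplitBregman.dualObj g f L) p)
    (hL : Function.Surjective (fun u : H₁ => ContinuousLinearMap.adjoint L (L u))) :
    SplitBregman.WellDefined g f L lam ∧
    ∀ (α β : ℕ → ℝ), Summable (fun k => α (k + 1) + β (k + 1)) →
    ∀ (u : ℕ → H₁) (d b : ℕ → H₂), SplitBregman.IsApproxRun g f L lam α β u d b →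
      ∃ dhat bhat : H₂,
        SplitBregman.WeakTendsto d dhat ∧
        SplitBregman.WeakTendsto b bhat ∧
        SplitBregman.IsSolution (SplitBregman.dualObj g f L) (lam • bhat) ∧
        Tendsto (fun k => d k - L (u (k + 1))) atTop (𝓝 0) ∧
        Summable (fun k => ‖d k - L (u (k + 1))‖ ^ 2) ∧
        ∃ uhat : H₁,
          L uhat = dhat ∧
          (∀ v : H₁, L v = dhat → v = uhat) ∧
          SplitBregman.IsSolution (SplitBregman.primalObj g f L) uhat ∧
          ∀ ubar : H₁, SplitBregman.IsWeakClusterPt u ubar → ubar = uhat := by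
  obtain ⟨κ, hκ, hbelow⟩ := SplitBregman.exists_norm_le_of_surjective hL
  have hinj : ∀ x y : H₁, L x = L y → x = y := fun x y h => by
    have := hbelow (x - y)
    rw [map_sub, h, sub_self, norm_zero, mul_zero] at this
    exact sub_eq_zero.1 (norm_le_zero_iff.1 this)
  refine ⟨hg.wellDefined hf hlam hκ hbelow, fun α β hsum u d b hrun => ?_⟩
  obtain ⟨x, hx⟩ := hP
  obtain ⟨q, hq⟩ := SplitBregman.exists_isKKT hg hf hreg hx
  obtain ⟨hres, z, w, hzw, hdz, hbw⟩ :=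
    hrun.exists_wTendsto hg hf hlam hκ hbelow ⟨x, q, hq⟩ hsum
  have hres0 : Tendsto (fun k => d k - L (u (k + 1))) atTop (𝓝 0) := by
    rw [tendsto_zero_iff_norm_tendsto_zero]
    simpa using hres.tendsto_atTop_zero.sqrt
  refine ⟨L z, w, SplitBregman.tendsto_toWeakSpace_iff.2 hdz,
    SplitBregman.tendsto_toWeakSpace_iff.2 hbw, hzw.isSolution_dual hg hf, hres0, hres, z, rfl,
    fun v hv => hinj v z hv, hzw.isSolution_primal hg hf, fun ubar hubar => hinj _ _ ?_⟩
  -- Only `L (u k)` is shown to converge weakly; `L` carries a weak cluster point of `u` to this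
  -- limit, and injectivity identifies it.
  have hLu : SplitBregman.WTendsto (fun k => L (u k)) atTop (L z) := fun y =>
    (tendsto_add_atTop_iff_nat 1).1 (hdz.of_sub_tendsto_zero (y := fun k => L (u (k + 1)))
      (by simpa using hres0.neg) y)
  obtain ⟨U, hU, hUu⟩ := mapClusterPt_iff_ultrafilter.1 hubar
  exact ((SplitBregman.tendsto_toWeakSpace_iff.1 hUu).map L).unique (hLu.mono hU)
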